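/- Fix $\alpha>1$, $s(0)<0$, $\dot r(0)>0$ and $\dot s(0)>0$. Let $\Delta=\alpha^2-1$, $\xi_1=-\alpha+\sqrt\Delta$, $\xi_2=-\alpha-\sqrt\Delta$, $t_0=-s(0)/\dot s(0)$ and $E=\dot r(0)^2\dot s(0)^2/(4\Delta)$. For $k>0$ let $\eta=e^{\xi_1t_0\sqrt k/2}$ and $\varepsilon=e^{(\xi_2-\xi_1)t_0\sqrt k}$, and let $R$ be the positive solution on $[0,\infty)$ of $$\ddot R-\frac{E(1-\varepsilon)^2}{R^3}+2\alpha\dot R+R=0,\qquad R(0)=\frac{\eta\,\dot r(0)(1-\varepsilon)}{2\sqrt\Delta},\qquad \dot R(0)=\frac{\eta\,\dot r(0)\,\xi_1(1-\varepsilon\xi_2/\xi_1)}{2\sqrt\Delta}.$$ Let $M=\begin{pmatrix}0&1\\-1&-2\alpha\end{pmatrix}$ and $Q=\int_0^\infty e^{sM^*}e^{sM}\,ds$, let $\lambda_1$ and $\lambda_2$ be the smallest and the largest eigenvalue of $Q$, write $x=(R,\dot R)^T$, and let $F(x)=x_1^2+E(1-\varepsilon)^2/x_1^2+x_2^2$.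 Fix any number $$\bar R>\max\left(\left(\frac{4E\lambda_2^{3/2}}{\lambda_1^{1/2}}\right)^{1/4},\ E^{1/4}\right)$$ and put $\bar F=\bar R^2+E(1-\varepsilon)^2\bar R^{-2}+\xi_1^2\bar R^2$. Theorem. There exist strictly positive numbers $R_m$, $R_M$, $V_M$, independent of $k$, such that for every $\zeta\in(0,1/|\xi_1|)$ there exist $C>0$ and $k_0>0$ for which the following holds for all $k\ge k_0$, with $\tau_3=\zeta\ln(1/\eta)$. The solution $R$ exists on $[0,\infty)$; there is a smallest time $\tau_4\in[\tau_3,\infty)$ such that $R(\tau_4)=\bar R$; this time satisfies $$\tau_4\le\tau_3+2\lambda_2\bigl[\ln\bigl(x^*Qx\bigr)(\tau_3)-\ln\bigl(\lambda_1\bar R^2\bigr)\bigr],\qquad \tau_4\le\tau_3+C\ln(1/\eta),$$ $$\xi_1\bar R\le\dot R(\tau_4)\le0,\qquad F(x(\tau_4))\le\bar F;$$ and for all $\tau\ge\tau_4$, $$R_m\le R(\tau)\le R_M,\qquad |\dot R(\tau)|\le V_M,$$ $$\frac{E(1-\varepsilon)}{\bar F}\le R(\tau)^2\le\bar F,\qquad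 \dot R(\tau)^2\le\bar F.$$ -/

import Mathlib

open Set

noncomputable section

namespace CornerPenalty

/-- The data of the problem that do not depend on the stiffness `k`: the damping parameter
`α > 1` and the initial data at the first impact, where `r` is the coordinate normal to the
first side of the wedge (with `r(0) = 0`) and `s` is the coordinate along it, measured
from the corner. -/
structure Data where
  /-- damping parameter `α` -/
  α : ℝ
  /-- initial position `s(0)` along the side -/
  s₀ : ℝ
  /-- initial normal velocity -/
  dr₀ : ℝ
  /-- initial tangential velocity -/
  ds₀ : ℝ
  one_lt_α : 1 < α
  s₀_neg : s₀ < 0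
  dr₀_pos : 0 < dr₀
  ds₀_pos : 0 < ds₀

namespace Data

variable (d : Data)

/-- `Δ = α² - 1`. -/
def Δ : ℝ := d.α ^ 2 - 1

/-- The larger root `ξ₁` of `ξ² + 2αξ + 1 = 0`. -/
def ξ₁ : ℝ := -d.α + Real.sqrt d.Δ

/-- The smaller root `ξ₂` of `ξ² + 2αξ + 1 = 0`. -/
def ξ₂ : ℝ := -d.α - Real.sqrt d.Δ

/-- The time `t₀` at which the free tangential motion reaches the corner. -/
def t₀ : ℝ := -d.s₀ / d.ds₀

/-- The constant `E = ṙ(0)² ṡ(0)² / (4Δ)`. -/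
def E : ℝ := d.dr₀ ^ 2 * d.ds₀ ^ 2 / (4 * d.Δ)

/-- The small scale `η = exp(ξ₁ t₀ √k / 2)`. -/
def η (k : ℝ) : ℝ := Real.exp (d.ξ₁ * d.t₀ * Real.sqrt k / 2)

/-- The small number `ε = exp((ξ₂ - ξ₁) t₀ √k)`. -/
def ε (k : ℝ) : ℝ := Real.exp ((d.ξ₂ - d.ξ₁) * d.t₀ * Real.sqrt k)

/-- The initial value `R(0)` of the scaled radius. -/
def initR (k : ℝ) : ℝ := d.η k * d.dr₀ * (1 - d.ε k) / (2 * Real.sqrt d.Δ)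

/-- The initial value `Ṙ(0)` of the scaled radial velocity. -/
def initV (k : ℝ) : ℝ :=
  d.η k * d.dr₀ * d.ξ₁ * (1 - d.ε k * d.ξ₂ / d.ξ₁) / (2 * Real.sqrt d.Δ)

/-- `R` is a positive solution on `[0, ∞)`, with velocity `V = Ṙ`, of
`R̈ - E (1 - ε)² / R³ + 2 α Ṙ + R = 0` with the initial data `initR`, `initV`
(derivatives are one-sided at `τ = 0`). -/
structure IsScaledMotion (k : ℝ) (R V : ℝ → ℝ) : Prop where
  pos : ∀ τ, 0 ≤ τ → 0 < R τ
  init_R : R 0 = d.initR k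
  init_V : V 0 = d.initV k
  deriv_R : ∀ τ, 0 ≤ τ → HasDerivWithinAt R (V τ) (Ici 0) τ
  deriv_V : ∀ τ, 0 ≤ τ →
    HasDerivWithinAt V (d.E * (1 - d.ε k) ^ 2 / R τ ^ 3 - 2 * d.α * V τ - R τ) (Ici 0) τ

/-- The time `τ₃ = ζ ln(1/η)`. -/
def τ₃ (ζ k : ℝ) : ℝ := ζ * Real.log (1 / d.η k)

/-- The matrix of the linear part of the first order system for `x = (R, Ṙ)`. -/
def M : Matrix (Fin 2) (Fin 2) ℝ := !![0, 1; -1, -2 * d.α]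

/-- `Q = ∫₀^∞ exp(s Mᵀ) exp(s M) ds`, the integral being taken entry by entry. -/
def Q : Matrix (Fin 2) (Fin 2) ℝ :=
  Matrix.of fun i j => ∫ s in Ioi (0 : ℝ),
    (NormedSpace.exp (s • d.M.transpose) * NormedSpace.exp (s • d.M)) i j

/-- The quadratic form `x* Q x` at `x = (R, V)`. -/
def quadForm (R V : ℝ) : ℝ := dotProduct ![R, V] (d.Q.mulVec ![R, V])

/-- The smallest eigenvalue of `Q`. -/
def lam₁ : ℝ := sInf (spectrum ℝ d.Q)

/-- The largest eigenvalue of `Q`. -/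
def lam₂ : ℝ := sSup (spectrum ℝ d.Q)

/-- The energy functional `F(x) = x₁² + E (1 - ε)² / x₁² + x₂²`. -/
def F (k R V : ℝ) : ℝ := R ^ 2 + d.E * (1 - d.ε k) ^ 2 / R ^ 2 + V ^ 2

/-- The energy level `F̄ = R̄² + E (1 - ε)² R̄⁻² + ξ₁² R̄²`. -/
def Fbar (k Rbar : ℝ) : ℝ :=
  Rbar ^ 2 + d.E * (1 - d.ε k) ^ 2 / Rbar ^ 2 + d.ξ₁ ^ 2 * Rbar ^ 2

/-- The threshold that `R̄` has to exceed. -/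
def threshold : ℝ :=
  max ((4 * d.E * d.lam₂ ^ (3 / 2 : ℝ) / d.lam₁ ^ (1 / 2 : ℝ)) ^ (1 / 4 : ℝ))
    (d.E ^ (1 / 4 : ℝ))

end Data

end CornerPenalty

end

/-!
Let `V = Ṙ`. The quantity `(V - ξ₁ R)² + E (1 - ε)² / R²` decays at most exponentially. Initially
it is of order `1 / η²`, because `R(0)` is of order `η`, so within unit time the singular force
pushes `R` up to order `1 / η`. From then on `Ṙ ≥ ξ₁ R` gives `R(τ) ≥ exp (ξ₁ (τ - 1)) R(1)`, and
since `1 + ξ₁ ζ > 0` the radius at `τ₃ = ζ ln (1 / η)` is still large. While `R ≥ R̄` the force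
`E / R³` is a small perturbation of the stable linear system, for which `x* Q x` is a Lyapunov
function decaying at rate `1 / (2 λ₂)`, so `R̄` is reached in a time of order `ln (1 / η)`. There
`ξ₁ R̄ ≤ Ṙ ≤ 0` puts the motion below the level `F̄` of the energy `F`, which never increases and
so confines the motion from then on.
-/

namespace CornerPenalty

section Comparison

open Real

variable {f f' S S' : ℝ → ℝ} {a b ξ : ℝ}

theorem exp_mul_add_sub_le_of_hasDerivWithinAt (hab : a ≤ b)
    (hf : ∀ t ∈ Icc a b, HasDerivWithinAt f (f' t) (Icc a b) t)
    (hS : ∀ t ∈ Icc a b, HasDerivWithinAt S (S' t) (Icc a b) t)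
    (h : ∀ t ∈ Icc a b, ξ * f t + exp (ξ * (t - a)) * S' t ≤ f' t) :
    exp (ξ * (b - a)) * (f a + (S b - S a)) ≤ f b := by
  have hexp (t : ℝ) : HasDerivWithinAt (fun t => exp (-(ξ * (t - a))))
      (exp (-(ξ * (t - a))) * -(ξ * 1)) (Icc a b) t :=
    (((hasDerivAt_id t).sub_const a).const_mul ξ).neg.exp.hasDerivWithinAt
  have hderiv (t : ℝ) (ht : t ∈ Icc a b) :=
    ((hexp t).mul (hf t ht)).sub (hS t ht)
  have hmono : MonotoneOn (fun t => exp (-(ξ * (t - a))) * f t - S t) (Icc a b) := by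
    refine monotoneOn_of_hasDerivWithinAt_nonneg (convex_Icc a b)
      (fun t ht => (hderiv t ht).continuousWithinAt)
      (fun t ht => (hderiv t (interior_subset ht)).mono interior_subset) fun t ht => ?_
    have hmul := mul_le_mul_of_nonneg_left (h t (interior_subset ht))
      (exp_pos (-(ξ * (t - a)))).le
    rw [mul_add, ← mul_assoc _ (exp _), ← exp_add, neg_add_cancel, exp_zero] at hmul
    linarith
  have hle := hmono (left_mem_Icc.2 hab) (right_mem_Icc.2 hab) hab
  simp only [sub_self, mul_zero, neg_zero, exp_zero, one_mul, exp_neg] at hle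
  rw [mul_comm, ← le_div_iff₀ (exp_pos _), div_eq_inv_mul]
  linarith

theorem exp_mul_le_of_hasDerivWithinAt (hab : a ≤ b)
    (hf : ∀ t ∈ Icc a b, HasDerivWithinAt f (f' t) (Icc a b) t)
    (h : ∀ t ∈ Icc a b, ξ * f t ≤ f' t) : exp (ξ * (b - a)) * f a ≤ f b := by
  simpa using exp_mul_add_sub_le_of_hasDerivWithinAt hab hf
    (fun t _ => hasDerivWithinAt_const t (Icc a b) 0) (by simpa using h)

end Comparison

section GlobalExistence

open Metric Filter Topology

variable {X : Type*} [NormedAddCommGroup X] [NormedSpace ℝ X] {v : ℝ → X → X}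

theorem exists_isIntegralCurveOn_Icc_of_Icc_of_Icc {f g : ℝ → X} {a b c : ℝ} (hab : a ≤ b)
    (hbc : b ≤ c) (hf : IsIntegralCurveOn f v (Icc a b)) (hg : IsIntegralCurveOn g v (Icc b c))
    (hfg : f b = g b) : ∃ γ, γ a = f a ∧ IsIntegralCurveOn γ v (Icc a c) := by
  set γ : ℝ → X := fun t => if t ≤ b then f t else g t
  have hγf : EqOn γ f (Icc a b) := fun t ht => if_pos ht.2
  have hγg : EqOn γ g (Icc b c) := fun t ht => by
    rcases ht.1.eq_or_lt with rfl | hbt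
    · simpa only [γ, le_refl, if_true] using hfg
    · exact if_neg hbt.not_ge
  have hleft (t : ℝ) : HasDerivWithinAt γ (v t (γ t)) (Icc a b) t := by
    by_cases ht : t ∈ Icc a b
    · rw [hγf ht]
      exact (hf t ht).congr_of_mem hγf ht
    · exact HasFDerivWithinAt.of_notMem_closure (by rwa [isClosed_Icc.closure_eq])
  have hright (t : ℝ) : HasDerivWithinAt γ (v t (γ t)) (Icc b c) t := by
    by_cases ht : t ∈ Icc b c
    · rw [hγg ht]
      exact (hg t ht).congr_of_mem hγg ht
    · exact HasFDerivWithinAt.of_notMem_closure (by rwa [isClosed_Icc.closure_eq])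
  refine ⟨γ, hγf (left_mem_Icc.2 hab), fun t _ => ?_⟩
  rw [← Icc_union_Icc_eq_Icc hab hbc]
  exact (hleft t).union (hright t)

theorem eqOn_of_isIntegralCurveOn_Icc {f g : ℝ → X} {a b : ℝ} {K : NNReal}
    (hv : ∀ t ∈ Icc a b, LipschitzWith K (v t)) (hf : IsIntegralCurveOn f v (Icc a b))
    (hg : IsIntegralCurveOn g v (Icc a b)) (hfg : f a = g a) : EqOn f g (Icc a b) := by
  have hright {γ : ℝ → X} (hγ : IsIntegralCurveOn γ v (Icc a b)) (t : ℝ) (ht : t ∈ Ico a b) :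
      HasDerivWithinAt γ (v t (γ t)) (Ici t) t :=
    (hγ t (Ico_subset_Icc_self ht)).mono_of_mem_nhdsWithin (Icc_mem_nhdsGE_of_mem ht)
  exact ODE_solution_unique_of_mem_Icc_right (s := fun _ => univ)
    (fun t ht => (hv t (Ico_subset_Icc_self ht)).lipschitzOnWith)
    (fun t ht => (hf t ht).continuousWithinAt) (hright hf) (fun _ _ => mem_univ _)
    (fun t ht => (hg t ht).continuousWithinAt) (hright hg) (fun _ _ => mem_univ _) hfg

variable [CompleteSpace X]

theorem exists_isIntegralCurveOn_Icc_of_mul_le {a b : ℝ} (hab : a ≤ b) {K : NNReal}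
    (hK : K * (b - a) ≤ 1 / 2) (hv : ∀ t ∈ Icc a b, LipschitzWith K (v t))
    (hc : ∀ x, ContinuousOn (fun t => v t x) (Icc a b)) (x₀ : X) :
    ∃ f, f a = x₀ ∧ IsIntegralCurveOn f v (Icc a b) := by
  obtain ⟨A, hA⟩ := isCompact_Icc.exists_bound_of_continuousOn (hc x₀)
  have hA₀ : 0 ≤ A := (norm_nonneg _).trans (hA a (left_mem_Icc.2 hab))
  lift A to NNReal using hA₀
  lift b - a to NNReal using sub_nonneg.2 hab with h hh
  -- The field is bounded by `A + K ρ` on the ball of radius `ρ`, and `(A + K ρ) h ≤ ρ`.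
  set ρ : NNReal := 2 * A * h
  have hpl : IsPicardLindelof v (⟨a, left_mem_Icc.2 hab⟩ : Icc a b) x₀ ρ 0 (A + K * ρ) K :=
    { lipschitzOnWith := fun t ht => (hv t ht).lipschitzOnWith
      continuousOn := fun x _ => hc x
      norm_le := fun t ht x hx => by
        have hdist : ‖v t x - v t x₀‖ ≤ K * ρ := by
          rw [← dist_eq_norm]
          exact ((hv t ht).dist_le_mul x x₀).trans (by gcongr; exact hx)
        calc ‖v t x‖ ≤ ‖v t x₀‖ + ‖v t x - v t x₀‖ := norm_le_insert' _ _
          _ ≤ A + K * ρ := add_le_add (hA t ht) hdist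
      mul_max_le := by
        have hKρ : K * ρ * h ≤ A * h := by
          calc (K * ρ * h : ℝ) = K * h * (2 * A * h) := by simp only [ρ]; push_cast; ring
            _ ≤ 1 / 2 * (2 * A * h) := by gcongr
            _ = A * h := by ring
        simp only [sub_self, ← hh, NNReal.zero_le_coe, sup_of_le_left]
        simp only [ρ] at hKρ ⊢
        push_cast at hKρ ⊢
        linarith }
  exact hpl.exists_eq_forall_mem_Icc_hasDerivWithinAt₀

theorem exists_isIntegralCurveOn_Icc {a b : ℝ} (hab : a ≤ b) {K : NNReal}
    (hv : ∀ t ∈ Icc a b, LipschitzWith K (v t))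
    (hc : ∀ x, ContinuousOn (fun t => v t x) (Icc a b)) (x₀ : X) :
    ∃ f, f a = x₀ ∧ IsIntegralCurveOn f v (Icc a b) := by
  obtain ⟨n, hn⟩ := pow_unbounded_of_one_lt (2 * (K * (b - a))) one_lt_two
  replace hn : K * (b - a) ≤ 2 ^ n / 2 := by linarith
  induction n generalizing a b x₀ with
  | zero => exact exists_isIntegralCurveOn_Icc_of_mul_le hab (by simpa using hn) hv hc x₀
  | succ n ih =>
    have ham : a ≤ midpoint ℝ a b := left_le_midpoint.2 hab
    have hmb : midpoint ℝ a b ≤ b := midpoint_le_right.2 hab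
    have hleft : Icc a (midpoint ℝ a b) ⊆ Icc a b := Icc_subset_Icc_right hmb
    have hright : Icc (midpoint ℝ a b) b ⊆ Icc a b := Icc_subset_Icc_left ham
    obtain ⟨f, hfa, hf⟩ := ih ham (fun t ht => hv t (hleft ht)) (fun x => (hc x).mono hleft) x₀
      (by rw [midpoint_sub_left, smul_eq_mul, invOf_eq_inv]; rw [pow_succ] at hn; linarith)
    obtain ⟨g, hg₀, hg⟩ := ih hmb (fun t ht => hv t (hright ht)) (fun x => (hc x).mono hright)
      (f (midpoint ℝ a b))
      (by rw [right_sub_midpoint, smul_eq_mul, invOf_eq_inv]; rw [pow_succ] at hn; linarith)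
    obtain ⟨γ, hγa, hγ⟩ := exists_isIntegralCurveOn_Icc_of_Icc_of_Icc ham hmb hf hg hg₀.symm
    exact ⟨γ, hγa.trans hfa, hγ⟩

theorem exists_isIntegralCurveOn_Ici {a : ℝ}
    (hv : ∀ T, ∃ K, ∀ t ∈ Icc a T, LipschitzWith K (v t))
    (hc : ∀ x, ContinuousOn (fun t => v t x) (Ici a)) (x₀ : X) :
    ∃ f, f a = x₀ ∧ IsIntegralCurveOn f v (Ici a) := by
  have hex (T : ℝ) (hT : a ≤ T) : ∃ f, f a = x₀ ∧ IsIntegralCurveOn f v (Icc a T) := by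
    obtain ⟨K, hK⟩ := hv T
    exact exists_isIntegralCurveOn_Icc hT hK (fun x => (hc x).mono Icc_subset_Ici_self) x₀
  choose! g hga hg using hex
  have hagree {t T : ℝ} (hat : a ≤ t) (htT : t ≤ T) : g T t = g t t := by
    obtain ⟨K, hK⟩ := hv t
    exact eqOn_of_isIntegralCurveOn_Icc hK ((hg T (hat.trans htT)).mono (Icc_subset_Icc_right htT))
      (hg t hat) ((hga T (hat.trans htT)).trans (hga t hat).symm) (right_mem_Icc.2 hat)
  refine ⟨fun t => g t t, hga a le_rfl, fun t hat => ?_⟩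
  have hlt : t < t + 1 := lt_add_one t
  have hIcc : Icc a (t + 1) ∈ 𝓝[Ici a] t := by
    rw [← Ici_inter_Iic]
    exact inter_mem_nhdsWithin _ (Iic_mem_nhds hlt)
  change HasDerivWithinAt _ (v t (g t t)) _ _
  rw [← hagree hat hlt.le]
  exact ((hg (t + 1) (le_add_of_le_of_nonneg hat zero_le_one) t ⟨hat, hlt.le⟩).congr_of_mem
    (fun s hs => (hagree hs.1 hs.2).symm) ⟨hat, hlt.le⟩).mono_of_mem_nhdsWithin hIcc

end GlobalExistence

/-- A positive solution `R` on `[0, ∞)`, with velocity `V = Ṙ`, of the linear oscillator with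
characteristic roots `a`, `b` subject to the repulsive force `e / R³`:
`R̈ = e / R³ + (a + b) Ṙ - a b R` (derivatives are one-sided at `0`). -/
structure IsRepelledMotion (a b e : ℝ) (R V : ℝ → ℝ) : Prop where
  pos : ∀ t, 0 ≤ t → 0 < R t
  deriv_R : ∀ t, 0 ≤ t → HasDerivWithinAt R (V t) (Ici 0) t
  deriv_V : ∀ t, 0 ≤ t →
    HasDerivWithinAt V (e / R t ^ 3 + (a + b) * V t - a * b * R t) (Ici 0) t

namespace IsRepelledMotion

open Real

variable {a b e : ℝ} {R V : ℝ → ℝ}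

theorem hasDerivWithinAt_sub (h : IsRepelledMotion a b e R V) {t : ℝ} (ht : 0 ≤ t) :
    HasDerivWithinAt (fun t => V t - a * R t) (b * (V t - a * R t) + e / R t ^ 3) (Ici 0) t :=
  ((h.deriv_V t ht).sub ((h.deriv_R t ht).const_mul a)).congr_deriv (by ring)

theorem exp_mul_sub_le (h : IsRepelledMotion a b e R V) (he : 0 ≤ e) {s t : ℝ} (hs : 0 ≤ s)
    (hst : s ≤ t) : exp (b * (t - s)) * (V s - a * R s) ≤ V t - a * R t := by
  have hsub : Icc s t ⊆ Ici 0 := fun τ hτ => hs.trans hτ.1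
  refine exp_mul_le_of_hasDerivWithinAt hst
    (fun τ hτ => (h.hasDerivWithinAt_sub (hsub hτ)).mono hsub) fun τ hτ => ?_
  exact le_add_of_nonneg_right (div_nonneg he (pow_pos (h.pos τ (hsub hτ)) 3).le)

theorem mul_le_velocity (h : IsRepelledMotion a b e R V) (he : 0 ≤ e) (h₀ : a * R 0 ≤ V 0)
    {t : ℝ} (ht : 0 ≤ t) : a * R t ≤ V t :=
  sub_nonneg.1 <|
    (mul_nonneg (exp_pos _).le (sub_nonneg.2 h₀)).trans (h.exp_mul_sub_le he le_rfl ht)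

theorem exp_mul_le (h : IsRepelledMotion a b e R V) (he : 0 ≤ e) (h₀ : a * R 0 ≤ V 0)
    {s t : ℝ} (hs : 0 ≤ s) (hst : s ≤ t) : exp (a * (t - s)) * R s ≤ R t := by
  have hsub : Icc s t ⊆ Ici 0 := fun τ hτ => hs.trans hτ.1
  exact exp_mul_le_of_hasDerivWithinAt hst (fun τ hτ => (h.deriv_R τ (hsub hτ)).mono hsub)
    fun τ hτ => h.mul_le_velocity he h₀ (hsub hτ)

theorem hasDerivWithinAt_div_sq (h : IsRepelledMotion a b e R V) {t : ℝ} (ht : 0 ≤ t) :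
    HasDerivWithinAt (fun t => e / R t ^ 2) (-(2 * e * V t / R t ^ 3)) (Ici 0) t := by
  have hR : R t ≠ 0 := (h.pos t ht).ne'
  refine ((hasDerivWithinAt_const t _ e).div ((h.deriv_R t ht).pow 2)
    (pow_ne_zero 2 hR)).congr_deriv ?_
  simp only [Nat.cast_ofNat, Nat.add_one_sub_one, Pi.pow_apply]
  field_simp
  ring

theorem antitoneOn_energy (h : IsRepelledMotion a b e R V) (hab : a + b ≤ 0) :
    AntitoneOn (fun t => a * b * R t ^ 2 + e / R t ^ 2 + V t ^ 2) (Ici 0) := by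
  have hderiv (t : ℝ) (ht : 0 ≤ t) : HasDerivWithinAt
      (fun t => a * b * R t ^ 2 + e / R t ^ 2 + V t ^ 2) (2 * (a + b) * V t ^ 2) (Ici 0) t := by
    refine (((((h.deriv_R t ht).pow 2).const_mul (a * b)).add (h.hasDerivWithinAt_div_sq ht)).add
      ((h.deriv_V t ht).pow 2)).congr_deriv ?_
    simp only [Nat.cast_ofNat, Nat.add_one_sub_one, pow_one]
    ring
  refine antitoneOn_of_hasDerivWithinAt_nonpos (convex_Ici 0)
    (fun t ht => (hderiv t ht).continuousWithinAt)
    (fun t ht => (hderiv t (interior_subset ht)).mono interior_subset) fun t _ => ?_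
  exact mul_nonpos_of_nonpos_of_nonneg (by linarith) (sq_nonneg _)

theorem exp_mul_sq_sub_add_div_le (h : IsRepelledMotion a b e R V) (he : 0 ≤ e) (hab : a + b ≤ 0)
    {t : ℝ} (ht : 0 ≤ t) :
    exp (2 * b * t) * ((V 0 - a * R 0) ^ 2 + e / R 0 ^ 2) ≤
      (V t - a * R t) ^ 2 + e / R t ^ 2 := by
  have hsub : Icc 0 t ⊆ Ici (0 : ℝ) := Icc_subset_Ici_self
  have hderiv (τ : ℝ) (hτ : 0 ≤ τ) := ((h.hasDerivWithinAt_sub hτ).pow 2).add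
    (h.hasDerivWithinAt_div_sq hτ)
  have hle := exp_mul_le_of_hasDerivWithinAt (ξ := 2 * b) ht
    (fun τ hτ => (hderiv τ (hsub hτ)).mono hsub) fun τ hτ => ?_
  · rw [sub_zero] at hle
    exact hle
  have hR := h.pos τ (hsub hτ)
  have hforce : 0 ≤ -(2 * (a + b) * (e / R τ ^ 2)) := by
    have : 0 ≤ e / R τ ^ 2 := by positivity
    nlinarith
  refine sub_nonneg.1 (hforce.trans_eq ?_)
  simp only [Pi.add_apply, Pi.pow_apply, Nat.cast_ofNat, Nat.add_one_sub_one, pow_one]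
  field_simp
  ring

theorem hasDerivWithinAt_mul_sub (h : IsRepelledMotion a b e R V) {t : ℝ} (ht : 0 ≤ t) :
    HasDerivWithinAt (fun t => R t * (V t - a * R t))
      ((a + b) * (R t * (V t - a * R t)) + ((V t - a * R t) ^ 2 + e / R t ^ 2)) (Ici 0) t := by
  have hR : R t ≠ 0 := (h.pos t ht).ne'
  refine ((h.deriv_R t ht).mul (h.hasDerivWithinAt_sub ht)).congr_deriv ?_
  field_simp
  ring

theorem exp_mul_mul_le_mul_sub (h : IsRepelledMotion a b e R V) (he : 0 ≤ e) (hab : a + b ≤ 0)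
    (hba : b ≤ a) (h₀ : a * R 0 ≤ V 0) {t T : ℝ} (ht : 0 ≤ t) (htT : t ≤ T) :
    exp ((a + b) * t) * (exp ((b - a) * T) * ((V 0 - a * R 0) ^ 2 + e / R 0 ^ 2) * t) ≤
      R t * (V t - a * R t) := by
  set H₀ := (V 0 - a * R 0) ^ 2 + e / R 0 ^ 2
  have hH₀ : 0 ≤ H₀ := by positivity
  have hsub : Icc 0 t ⊆ Ici (0 : ℝ) := Icc_subset_Ici_self
  have hle := exp_mul_add_sub_le_of_hasDerivWithinAt (ξ := a + b)
    (S := fun τ => exp ((b - a) * T) * H₀ * τ) (S' := fun _ => exp ((b - a) * T) * H₀ * 1) ht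
    (fun τ hτ => (h.hasDerivWithinAt_mul_sub (hsub hτ)).mono hsub)
    (fun τ _ => (hasDerivWithinAt_id τ _).const_mul _) fun τ hτ => ?_
  · refine le_trans ?_ hle
    rw [sub_zero, mul_zero, sub_zero]
    gcongr
    exact le_add_of_nonneg_left (mul_nonneg (h.pos 0 le_rfl).le (sub_nonneg.2 h₀))
  · have hexp : exp ((a + b) * τ) * exp ((b - a) * T) ≤ exp (2 * b * τ) := by
      rw [← exp_add, exp_le_exp]
      nlinarith [hτ.2.trans htT]
    have := (mul_le_mul_of_nonneg_right hexp hH₀).trans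
      (h.exp_mul_sq_sub_add_div_le he hab hτ.1)
    rw [sub_zero]
    linarith

theorem sq_mul_exp_mul_le_sq (h : IsRepelledMotion a b e R V) (he : 0 ≤ e) (hab : a + b ≤ 0)
    (hba : b ≤ a) (h₀ : a * R 0 ≤ V 0) {T : ℝ} (hT : 0 ≤ T) :
    T ^ 2 * (exp (2 * b * T) * ((V 0 - a * R 0) ^ 2 + e / R 0 ^ 2)) ≤ R T ^ 2 := by
  set H₀ := (V 0 - a * R 0) ^ 2 + e / R 0 ^ 2
  set c := exp ((b - a) * T) * (exp ((b - a) * T) * H₀)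
  have hsub : Icc 0 T ⊆ Ici (0 : ℝ) := Icc_subset_Ici_self
  have hle := exp_mul_add_sub_le_of_hasDerivWithinAt (ξ := 2 * a)
    (S := fun t => c * t ^ 2) (S' := fun t => c * (2 * t)) hT
    (fun t ht => ((h.deriv_R t (hsub ht)).pow 2).mono hsub)
    (fun t _ => by simpa using (((hasDerivAt_id t).pow 2).const_mul c).hasDerivWithinAt)
    fun t ht => ?_
  · have hexp : exp (2 * b * T) = exp (2 * a * T) * (exp ((b - a) * T) * exp ((b - a) * T)) := by
      rw [← exp_add, ← exp_add]; ring_nf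
    refine le_trans ?_ hle
    rw [sub_zero, hexp]
    calc T ^ 2 * (exp (2 * a * T) * (exp ((b - a) * T) * exp ((b - a) * T)) * H₀)
        = exp (2 * a * T) * (c * T ^ 2) := by simp only [c]; ring
      _ ≤ exp (2 * a * T) * ((R ^ 2) 0 + (c * T ^ 2 - c * 0 ^ 2)) := by
        gcongr
        simp only [Pi.pow_apply]
        linarith [sq_nonneg (R 0)]
  · have hexp : exp (2 * a * t) * exp ((b - a) * T) ≤ exp ((a + b) * t) := by
      rw [← exp_add, exp_le_exp]
      nlinarith [ht.2]
    have hforce : 0 ≤ exp ((b - a) * T) * H₀ * t :=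
      mul_nonneg (by positivity) ht.1
    have := (mul_le_mul_of_nonneg_right hexp hforce).trans
      (h.exp_mul_mul_le_mul_sub he hab hba h₀ ht.1 ht.2)
    simp only [Pi.pow_apply, Nat.cast_ofNat, Nat.add_one_sub_one, pow_one, sub_zero, c]
    linarith

end IsRepelledMotion

section RepelledMotionExistence

open Real

theorem lipschitzOnWith_inv_pow_Ici {m : ℝ} (hm : 0 < m) (n : ℕ) :
    LipschitzOnWith (n / m ^ (n + 1)).toNNReal (fun x => (x ^ n)⁻¹) (Ici m) := by
  have hderiv (x : ℝ) (hx : x ∈ Ici m) : HasDerivWithinAt (fun x => (x ^ n)⁻¹)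
      (-(n / x ^ (n + 1))) (Ici m) x := by
    have hx₀ : x ≠ 0 := (hm.trans_le hx).ne'
    refine ((hasDerivAt_pow n x).inv (pow_ne_zero n hx₀)).hasDerivWithinAt.congr_deriv ?_
    cases n with
    | zero => simp
    | succ n => simp only [Nat.add_one_sub_one]; field_simp; ring
  refine (convex_Ici m).lipschitzOnWith_of_nnnorm_hasDerivWithin_le hderiv fun x hx => ?_
  have hx₀ : 0 < x := hm.trans_le hx
  rw [nnnorm_neg, ← NNReal.coe_le_coe, coe_nnnorm, Real.norm_of_nonneg (by positivity),
    Real.coe_toNNReal _ (by positivity)]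
  gcongr
  exact hx

/-- The first order system of a repelled motion for `x = (R, V)`, with the radius in the force
truncated from below by `ρ t`, which makes the field globally Lipschitz. -/
noncomputable def truncatedField (a b e : ℝ) (ρ : ℝ → ℝ) (t : ℝ) (x : ℝ × ℝ) : ℝ × ℝ :=
  (x.2, e * (max x.1 (ρ t) ^ 3)⁻¹ + ((a + b) * x.2 - a * b * x.1))

theorem exists_lipschitzWith_truncatedField (a b e : ℝ) {ρ : ℝ → ℝ} {s : Set ℝ} {m : ℝ}
    (hm : 0 < m) (hρ : ∀ t ∈ s, m ≤ ρ t) :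
    ∃ K, ∀ t ∈ s, LipschitzWith K (truncatedField a b e ρ t) := by
  set L : ℝ × ℝ →L[ℝ] ℝ :=
    (a + b) • ContinuousLinearMap.snd ℝ ℝ ℝ - (a * b) • ContinuousLinearMap.fst ℝ ℝ ℝ
  have hinv (t : ℝ) (ht : t ∈ s) : LipschitzWith ((3 : ℕ) / m ^ (3 + 1)).toNNReal
      (fun x : ℝ × ℝ => (max x.1 (ρ t) ^ 3)⁻¹) := by
    rw [← lipschitzOnWith_univ, ← mul_one (Real.toNNReal _)]
    exact (lipschitzOnWith_inv_pow_Ici hm 3).comp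
      (LipschitzWith.prod_fst.max_const (ρ t)).lipschitzOnWith
      fun x _ => (hρ t ht).trans (le_max_right _ _)
  exact ⟨_, fun t ht => LipschitzWith.prod_snd.prodMk
    (((lipschitzWith_smul e).comp (hinv t ht)).add L.lipschitz)⟩

theorem continuous_truncatedField (a b e : ℝ) {ρ : ℝ → ℝ} (hρc : Continuous ρ)
    (hρ : ∀ t, 0 < ρ t) (x : ℝ × ℝ) : Continuous fun t => truncatedField a b e ρ t x := by
  have hmax (t : ℝ) : max x.1 (ρ t) ^ 3 ≠ 0 := (pow_pos ((hρ t).trans_le (le_max_right _ _)) 3).ne'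
  unfold truncatedField
  fun_prop (disch := assumption)

theorem exists_isRepelledMotion (a : ℝ) {b e r₀ v₀ : ℝ} (he : 0 ≤ e) (hr₀ : 0 < r₀)
    (hv₀ : a * r₀ ≤ v₀) : ∃ R V, R 0 = r₀ ∧ V 0 = v₀ ∧ IsRepelledMotion a b e R V := by
  -- The solution stays above this level, as `Ṙ ≥ a R` persists, so the truncation is never active.
  set ρ : ℝ → ℝ := fun t => exp (a * t) * r₀
  have hρ (t : ℝ) : 0 < ρ t := mul_pos (exp_pos _) hr₀
  have hmax (x t : ℝ) : 0 < max x (ρ t) := (hρ t).trans_le (le_max_right _ _)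
  have hρc : Continuous ρ := by fun_prop
  obtain ⟨x, hx₀, hx⟩ := exists_isIntegralCurveOn_Ici (v := truncatedField a b e ρ) (a := 0)
    (fun T => by
      obtain ⟨m, hm, hmρ⟩ := isCompact_Icc.exists_forall_le' hρc.continuousOn fun t _ => hρ t
      exact exists_lipschitzWith_truncatedField a b e hm hmρ)
    (fun y => (continuous_truncatedField a b e hρc hρ y).continuousOn) (r₀, v₀)
  have hR (t : ℝ) (ht : 0 ≤ t) : HasDerivWithinAt (fun t => (x t).1) (x t).2 (Ici 0) t :=
    (hx t ht).hasFDerivWithinAt.fst.hasDerivWithinAt.congr_deriv (by simp [truncatedField])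
  have hV (t : ℝ) (ht : 0 ≤ t) : HasDerivWithinAt (fun t => (x t).2)
      (e * (max (x t).1 (ρ t) ^ 3)⁻¹ + ((a + b) * (x t).2 - a * b * (x t).1)) (Ici 0) t :=
    (hx t ht).hasFDerivWithinAt.snd.hasDerivWithinAt.congr_deriv (by simp [truncatedField])
  have hgap (t : ℝ) (ht : 0 ≤ t) : a * (x t).1 ≤ (x t).2 := by
    have hle := exp_mul_le_of_hasDerivWithinAt (ξ := b) ht
      (fun τ hτ => ((hV τ hτ.1).sub ((hR τ hτ.1).const_mul a)).mono Icc_subset_Ici_self)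
      fun τ _ => by
        have := mul_nonneg he (inv_pos.2 (pow_pos (hmax (x τ).1 τ) 3)).le
        simp only [Pi.sub_apply]
        linarith
    simp only [Pi.sub_apply, hx₀] at hle
    exact sub_nonneg.1 ((mul_nonneg (exp_pos _).le (sub_nonneg.2 hv₀)).trans hle)
  have hρR (t : ℝ) (ht : 0 ≤ t) : ρ t ≤ (x t).1 := by
    simpa only [hx₀, sub_zero] using exp_mul_le_of_hasDerivWithinAt ht
      (fun τ hτ => (hR τ hτ.1).mono Icc_subset_Ici_self) fun τ hτ => hgap τ hτ.1
  refine ⟨fun t => (x t).1, fun t => (x t).2, congrArg Prod.fst hx₀, congrArg Prod.snd hx₀,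
    fun t ht => (hρ t).trans_le (hρR t ht), hR, fun t ht => (hV t ht).congr_deriv ?_⟩
  rw [max_eq_left (hρR t ht)]
  ring

end RepelledMotionExistence

section Lyapunov

open Matrix MeasureTheory Filter Asymptotics Topology

variable {n : Type*} [Fintype n] {A : Matrix n n ℝ}

theorem dotProduct_mulVec_comm_of_isHermitian (hA : A.IsHermitian) (x y : n → ℝ) :
    x ⬝ᵥ A *ᵥ y = y ⬝ᵥ A *ᵥ x := by
  rw [← dotProduct_transpose_mulVec, ← conjTranspose_eq_transpose_of_trivial, hA.eq]

theorem two_mul_dotProduct_mulVec_sub_le (hA : A.PosSemidef) {L : ℝ} (hL : 0 < L)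
    (hAL : ∀ y : n → ℝ, y ⬝ᵥ A *ᵥ y ≤ L * (y ⬝ᵥ y)) {x b : n → ℝ}
    (hb : 16 * L ^ 3 * (b ⬝ᵥ b) ≤ x ⬝ᵥ A *ᵥ x) :
    2 * (b ⬝ᵥ A *ᵥ x) - x ⬝ᵥ x ≤ -(1 / (2 * L)) * (x ⬝ᵥ A *ᵥ x) := by
  -- Young's inequality for the mixed term `bᵀ A x`, with the weight that makes `hb` absorb it.
  have hsq := hA.dotProduct_mulVec_nonneg (x - (4 * L) • b)
  simp only [star_trivial, mulVec_sub, mulVec_smul, sub_dotProduct, dotProduct_sub,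
    smul_dotProduct, dotProduct_smul, smul_eq_mul,
    dotProduct_mulVec_comm_of_isHermitian hA.isHermitian x b] at hsq
  have hbL := mul_le_mul_of_nonneg_left (hAL b) (sq_nonneg (4 * L))
  rw [neg_mul, one_div_mul_eq_div, le_neg, div_le_iff₀ (by positivity)]
  linarith [hAL x]

theorem hasDerivWithinAt_dotProduct_mulVec (A : Matrix n n ℝ) {x : ℝ → n → ℝ} {x' : n → ℝ}
    {S : Set ℝ} {t : ℝ} (hx : HasDerivWithinAt x x' S t) :
    HasDerivWithinAt (fun t => x t ⬝ᵥ A *ᵥ x t) (x' ⬝ᵥ A *ᵥ x t + x t ⬝ᵥ A *ᵥ x') S t := by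
  have hx (i : n) := hasDerivWithinAt_pi.1 hx i
  have hAx (i : n) := HasDerivWithinAt.fun_sum fun j (_ : j ∈ Finset.univ) =>
    (hx j).const_mul (A i j)
  refine (HasDerivWithinAt.fun_sum fun i (_ : i ∈ Finset.univ) =>
    (hx i).mul (hAx i)).congr_deriv ?_
  simp only [dotProduct, mulVec, Finset.sum_add_distrib]

variable [DecidableEq n]

theorem sInf_spectrum_mul_le (hA : A.IsHermitian) (x : n → ℝ) :
    sInf (spectrum ℝ A) * (x ⬝ᵥ x) ≤ x ⬝ᵥ A *ᵥ x := by
  have hpsd : (A - algebraMap ℝ (Matrix n n ℝ) (sInf (spectrum ℝ A))).PosSemidef := by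
    rw [posSemidef_iff_isHermitian_and_spectrum_nonneg, ← spectrum.sub_singleton_eq]
    refine ⟨hA.sub (isHermitian_diagonal _), ?_⟩
    rintro - ⟨l, hl, -, rfl, rfl⟩
    exact sub_nonneg.2 (csInf_le A.finite_real_spectrum.bddBelow hl)
  simpa [sub_mulVec, dotProduct_sub, Algebra.algebraMap_eq_smul_one, smul_mulVec] using
    hpsd.dotProduct_mulVec_nonneg x

theorem le_sSup_spectrum_mul (hA : A.IsHermitian) (x : n → ℝ) :
    x ⬝ᵥ A *ᵥ x ≤ sSup (spectrum ℝ A) * (x ⬝ᵥ x) := by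
  have hpsd : (algebraMap ℝ (Matrix n n ℝ) (sSup (spectrum ℝ A)) - A).PosSemidef := by
    rw [posSemidef_iff_isHermitian_and_spectrum_nonneg, ← spectrum.singleton_sub_eq]
    refine ⟨(isHermitian_diagonal _).sub hA, ?_⟩
    rintro - ⟨-, rfl, l, hl, rfl⟩
    exact sub_nonneg.2 (le_csSup A.finite_real_spectrum.bddAbove hl)
  simpa [sub_mulVec, dotProduct_sub, Algebra.algebraMap_eq_smul_one, smul_mulVec] using
    hpsd.dotProduct_mulVec_nonneg x

theorem sInf_spectrum_pos [Nonempty n] (hA : A.PosDef) : 0 < sInf (spectrum ℝ A) := by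
  have hmem : sInf (spectrum ℝ A) ∈ spectrum ℝ A :=
    Nonempty.csInf_mem ⟨_, hA.isHermitian.eigenvalues_mem_spectrum_real (Classical.arbitrary n)⟩
      A.finite_real_spectrum
  rw [hA.isHermitian.spectrum_real_eq_range_eigenvalues] at hmem ⊢
  obtain ⟨i, hi⟩ := hmem
  exact hi ▸ hA.eigenvalues_pos i

theorem sSup_spectrum_pos [Nonempty n] (hA : A.PosDef) : 0 < sSup (spectrum ℝ A) :=
  (hA.eigenvalues_pos (Classical.arbitrary n)).trans_le <|
    le_csSup A.finite_real_spectrum.bddAbove (hA.isHermitian.eigenvalues_mem_spectrum_real _)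

/-- Exponential stability of the linear system `ẋ = A x`: every entry of `exp (s A)` is
`O(exp (-β s))` as `s → ∞`, for some rate `β > 0`. -/
def IsExpStable (A : Matrix n n ℝ) : Prop :=
  ∃ β > 0, ∀ i j, (fun s : ℝ => NormedSpace.exp (s • A) i j) =O[atTop] fun s => Real.exp (-β * s)

/-- The kernel `exp (s Aᵀ) exp (s A)` of the solution of the Lyapunov equation. -/
noncomputable def lyapunovKernel (A : Matrix n n ℝ) (s : ℝ) : Matrix n n ℝ :=
  NormedSpace.exp (s • Aᵀ) * NormedSpace.exp (s • A)

/-- `∫₀^∞ exp (s Aᵀ) exp (s A) ds`, entry by entry. It solves the Lyapunov equation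
`Aᵀ Q + Q A = -1` when `A` is exponentially stable. -/
noncomputable def lyapunovIntegral (A : Matrix n n ℝ) : Matrix n n ℝ :=
  Matrix.of fun i j => ∫ s in Ioi (0 : ℝ), lyapunovKernel A s i j

theorem isExpStable_conj_diagonal {P : Matrix n n ℝ} (hP : IsUnit P) {μ : n → ℝ} {β : ℝ}
    (hβ : 0 < β) (hμ : ∀ k, μ k ≤ -β) : IsExpStable (P * diagonal μ * P⁻¹) := by
  refine ⟨β, hβ, fun i j => ?_⟩
  have hentry (s : ℝ) : NormedSpace.exp (s • (P * diagonal μ * P⁻¹)) i j =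
      ∑ k, P i k * Real.exp (s * μ k) * P⁻¹ k j := by
    have hsmul : s • (P * diagonal μ * P⁻¹) = P * diagonal (s • μ) * P⁻¹ := by
      rw [diagonal_smul, Matrix.mul_smul, Matrix.smul_mul]
    rw [hsmul, exp_conj _ _ hP, exp_diagonal, mul_apply]
    simp only [mul_diagonal, Pi.coe_exp, Pi.smul_apply, smul_eq_mul, Real.exp_eq_exp_ℝ]
  simp only [hentry]
  refine IsBigO.fun_sum fun k _ => ?_
  have hexp : (fun s => Real.exp (s * μ k)) =O[atTop] fun s => Real.exp (-β * s) := by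
    refine IsBigO.of_norm_eventuallyLE ((eventually_ge_atTop 0).mono fun s hs => ?_)
    change ‖Real.exp (s * μ k)‖ ≤ Real.exp (-β * s)
    rw [Real.norm_of_nonneg (Real.exp_pos _).le, Real.exp_le_exp, mul_comm]
    exact mul_le_mul_of_nonneg_right (hμ k) hs
  simpa only [mul_comm _ (P⁻¹ k j), mul_assoc] using
    (hexp.const_mul_left (P i k)).const_mul_left (P⁻¹ k j)

theorem lyapunovKernel_eq (A : Matrix n n ℝ) (s : ℝ) :
    lyapunovKernel A s = (NormedSpace.exp (s • A))ᵀ * NormedSpace.exp (s • A) := by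
  rw [lyapunovKernel, ← transpose_smul, exp_transpose]

theorem lyapunovKernel_zero (A : Matrix n n ℝ) : lyapunovKernel A 0 = 1 := by
  simp only [lyapunovKernel, zero_smul, NormedSpace.exp_zero, mul_one]

open scoped Matrix.Norms.Operator in
theorem hasDerivAt_lyapunovKernel (A : Matrix n n ℝ) (s : ℝ) (i j : n) :
    HasDerivAt (fun s => lyapunovKernel A s i j)
      ((Aᵀ * lyapunovKernel A s + lyapunovKernel A s * A) i j) s := by
  have h := (hasDerivAt_exp_smul_const' Aᵀ s).mul (hasDerivAt_exp_smul_const A s)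
  refine (hasDerivAt_pi.1 (hasDerivAt_pi.1 h i) j).congr_deriv ?_
  simp only [lyapunovKernel, Matrix.mul_assoc]
  rfl

theorem continuous_lyapunovKernel_apply (A : Matrix n n ℝ) (i j : n) :
    Continuous fun s => lyapunovKernel A s i j :=
  continuous_iff_continuousAt.2 fun s => (hasDerivAt_lyapunovKernel A s i j).continuousAt

namespace IsExpStable

theorem exists_lyapunovKernel_isBigO (hA : IsExpStable A) :
    ∃ β > 0, ∀ i j, (fun s => lyapunovKernel A s i j) =O[atTop] fun s => Real.exp (-β * s) := by
  obtain ⟨β, hβ, hO⟩ := hA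
  refine ⟨β + β, add_pos hβ hβ, fun i j => ?_⟩
  simp only [lyapunovKernel_eq, mul_apply, transpose_apply, neg_add, add_mul, Real.exp_add]
  exact IsBigO.fun_sum fun k _ => (hO k i).mul (hO k j)

theorem integrableOn_lyapunovKernel (hA : IsExpStable A) (i j : n) :
    IntegrableOn (fun s => lyapunovKernel A s i j) (Ioi 0) := by
  obtain ⟨β, hβ, hO⟩ := hA.exists_lyapunovKernel_isBigO
  exact integrable_of_isBigO_exp_neg hβ (continuous_lyapunovKernel_apply A i j).continuousOn
    (hO i j)

theorem tendsto_lyapunovKernel (hA : IsExpStable A) (i j : n) :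
    Tendsto (fun s => lyapunovKernel A s i j) atTop (𝓝 0) := by
  obtain ⟨β, hβ, hO⟩ := hA.exists_lyapunovKernel_isBigO
  refine (hO i j).trans_tendsto (Real.tendsto_exp_atBot.comp ?_)
  exact tendsto_id.const_mul_atTop_of_neg (neg_neg_of_pos hβ)

theorem transpose_mul_lyapunovIntegral_add (hA : IsExpStable A) :
    Aᵀ * lyapunovIntegral A + lyapunovIntegral A * A = -1 := by
  ext i j
  have hkernel (k l : n) : Integrable (fun s => lyapunovKernel A s k l) (volume.restrict (Ioi 0)) :=
    hA.integrableOn_lyapunovKernel k l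
  have hleft (k : n) := (hkernel k j).const_mul (A k i)
  have hright (k : n) := (hkernel i k).mul_const (A k j)
  calc (Aᵀ * lyapunovIntegral A + lyapunovIntegral A * A) i j
      = ∫ s in Ioi 0, (Aᵀ * lyapunovKernel A s + lyapunovKernel A s * A) i j := by
        simp only [Matrix.add_apply, mul_apply, transpose_apply, lyapunovIntegral, of_apply]
        rw [integral_add (integrable_finsetSum _ fun k _ => hleft k)
          (integrable_finsetSum _ fun k _ => hright k), integral_finsetSum _ fun k _ => hleft k,
          integral_finsetSum _ fun k _ => hright k]
        simp only [integral_const_mul, integral_mul_const]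
    _ = 0 - lyapunovKernel A 0 i j := by
        refine integral_Ioi_of_hasDerivAt_of_tendsto'
          (fun s _ => hasDerivAt_lyapunovKernel A s i j) ?_ (hA.tendsto_lyapunovKernel i j)
        simp only [Matrix.add_apply, mul_apply, transpose_apply]
        exact (integrable_finsetSum _ fun k _ => hleft k).add
          (integrable_finsetSum _ fun k _ => hright k)
    _ = (-1 : Matrix n n ℝ) i j := by rw [lyapunovKernel_zero, zero_sub, Matrix.neg_apply]

theorem dotProduct_lyapunovIntegral_mulVec (hA : IsExpStable A) (x : n → ℝ) :
    x ⬝ᵥ lyapunovIntegral A *ᵥ x = ∫ s in Ioi 0, x ⬝ᵥ lyapunovKernel A s *ᵥ x := by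
  have hkernel (i j : n) : Integrable (fun s => x i * (lyapunovKernel A s i j * x j))
      (volume.restrict (Ioi 0)) :=
    ((hA.integrableOn_lyapunovKernel i j).mul_const _).const_mul _
  simp only [dotProduct, mulVec, lyapunovIntegral, of_apply, Finset.mul_sum]
  rw [integral_finsetSum _ fun i _ => integrable_finsetSum _ fun j _ => hkernel i j]
  refine Finset.sum_congr rfl fun i _ => ?_
  rw [integral_finsetSum _ fun j _ => hkernel i j]
  simp only [integral_const_mul, integral_mul_const]

theorem posSemidef_lyapunovIntegral (hA : IsExpStable A) : (lyapunovIntegral A).PosSemidef := by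
  refine .of_dotProduct_mulVec_nonneg ?_ fun x => ?_
  · ext i j
    simp only [conjTranspose_apply, star_trivial, lyapunovIntegral, of_apply, lyapunovKernel_eq,
      mul_apply, transpose_apply, mul_comm]
  · rw [star_trivial, hA.dotProduct_lyapunovIntegral_mulVec]
    refine integral_nonneg fun s => ?_
    simpa only [Pi.zero_apply, lyapunovKernel_eq, conjTranspose_eq_transpose_of_trivial,
      star_trivial] using
      (posSemidef_conjTranspose_mul_self (NormedSpace.exp (s • A))).dotProduct_mulVec_nonneg x

theorem posDef_lyapunovIntegral (hA : IsExpStable A) : (lyapunovIntegral A).PosDef := by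
  have hpsd := hA.posSemidef_lyapunovIntegral
  refine .of_dotProduct_mulVec_pos hpsd.isHermitian fun x hx => ?_
  refine (hpsd.dotProduct_mulVec_nonneg x).lt_of_ne' fun h₀ => hx ?_
  have hQx : lyapunovIntegral A *ᵥ x = 0 := (hpsd.dotProduct_mulVec_zero_iff x).1 h₀
  have hLyap := congrArg (fun B => x ⬝ᵥ B *ᵥ x) hA.transpose_mul_lyapunovIntegral_add
  simp only [add_mulVec, ← mulVec_mulVec, dotProduct_add, neg_mulVec, one_mulVec, dotProduct_neg,
    dotProduct_mulVec_comm_of_isHermitian hpsd.isHermitian x (A *ᵥ x), hQx, mulVec_zero,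
    dotProduct_zero] at hLyap
  exact dotProduct_self_eq_zero.1 (by linarith)

end IsExpStable

theorem IsExpStable.dotProduct_lyapunovIntegral_le_exp_mul (hA : IsExpStable A) {L : ℝ}
    (hL : 0 < L) (hAL : ∀ y : n → ℝ, y ⬝ᵥ lyapunovIntegral A *ᵥ y ≤ L * (y ⬝ᵥ y))
    {x b : ℝ → n → ℝ} {s t : ℝ} (hst : s ≤ t)
    (hx : ∀ τ ∈ Icc s t, HasDerivWithinAt x (A *ᵥ x τ + b τ) (Icc s t) τ)
    (hb : ∀ τ ∈ Icc s t, 16 * L ^ 3 * (b τ ⬝ᵥ b τ) ≤ x τ ⬝ᵥ lyapunovIntegral A *ᵥ x τ) :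
    x t ⬝ᵥ lyapunovIntegral A *ᵥ x t ≤
      Real.exp (-(1 / (2 * L)) * (t - s)) * (x s ⬝ᵥ lyapunovIntegral A *ᵥ x s) := by
  have hQ := hA.posSemidef_lyapunovIntegral
  have hderiv (τ : ℝ) (hτ : τ ∈ Icc s t) :
      HasDerivWithinAt (fun τ => -(x τ ⬝ᵥ lyapunovIntegral A *ᵥ x τ))
        (-(2 * (b τ ⬝ᵥ lyapunovIntegral A *ᵥ x τ) - x τ ⬝ᵥ x τ)) (Icc s t) τ := by
    refine (hasDerivWithinAt_dotProduct_mulVec (lyapunovIntegral A) (hx τ hτ)).neg.congr_deriv ?_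
    have hLyap := congrArg (fun B => x τ ⬝ᵥ B *ᵥ x τ) hA.transpose_mul_lyapunovIntegral_add
    have hcomm := dotProduct_mulVec_comm_of_isHermitian hQ.isHermitian (x τ)
    simp only [add_mulVec, ← mulVec_mulVec, dotProduct_add, neg_mulVec, one_mulVec,
      dotProduct_neg, dotProduct_transpose_mulVec, dotProduct_comm _ (A *ᵥ x τ), hcomm] at hLyap
    simp only [mulVec_add, add_dotProduct, dotProduct_add, hcomm]
    linarith
  have hle := exp_mul_le_of_hasDerivWithinAt (ξ := -(1 / (2 * L))) hst hderiv fun τ hτ => by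
    linarith [two_mul_dotProduct_mulVec_sub_le hQ hL hAL (hb τ hτ)]
  linarith

end Lyapunov

section Descent

open Matrix

/-- The matrix of the first order system for `x = (R, Ṙ)` with characteristic roots `a`, `b`,
that is, for `R̈ = (a + b) Ṙ - a b R`. -/
def companion (a b : ℝ) : Matrix (Fin 2) (Fin 2) ℝ := !![0, 1; -(a * b), a + b]

theorem isExpStable_companion {a b : ℝ} (hba : b < a) (ha : a < 0) :
    IsExpStable (companion a b) := by
  let P : Matrix (Fin 2) (Fin 2) ℝ := !![1, 1; a, b]
  have hdet : IsUnit P.det := by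
    rw [det_fin_two_of, one_mul, one_mul]
    exact (sub_ne_zero.2 hba.ne).isUnit
  have hdiag : companion a b * P = P * diagonal ![a, b] := by
    ext i j
    fin_cases i <;> fin_cases j <;>
      simp [companion, P, Matrix.mul_apply, Fin.sum_univ_two] <;> ring
  rw [← mul_nonsing_inv_cancel_right _ (companion a b) hdet, hdiag]
  exact isExpStable_conj_diagonal ((isUnit_iff_isUnit_det P).2 hdet) (neg_pos.2 ha)
    (Fin.forall_fin_two.2 ⟨(neg_neg a).ge, hba.le.trans (neg_neg a).ge⟩)

theorem companion_mulVec (a b x y : ℝ) :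
    companion a b *ᵥ ![x, y] = ![y, (a + b) * y - a * b * x] := by
  simp only [companion, cons_mulVec, cons_dotProduct, dotProduct_of_isEmpty, empty_mulVec,
    head_cons, tail_cons, zero_mul, one_mul, zero_add, add_zero, neg_mul, neg_add_eq_sub]

namespace IsRepelledMotion

variable {a b e : ℝ} {R V : ℝ → ℝ}

theorem hasDerivWithinAt_state (h : IsRepelledMotion a b e R V) {t : ℝ} (ht : 0 ≤ t) :
    HasDerivWithinAt (fun t => ![R t, V t])
      (companion a b *ᵥ ![R t, V t] + ![0, e / R t ^ 3]) (Ici 0) t := by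
  refine hasDerivWithinAt_pi.2 (Fin.forall_fin_two.2 ⟨?_, ?_⟩)
  · exact (h.deriv_R t ht).congr_deriv (by
      simp only [companion_mulVec, Pi.add_apply, cons_val_zero, add_zero])
  · exact (h.deriv_V t ht).congr_deriv (by
      simp only [companion_mulVec, Pi.add_apply, cons_val_one, cons_val_fin_one]; ring)

theorem sub_le_log_sub_log (h : IsRepelledMotion a b e R V) (hba : b < a) (ha : a < 0)
    {l L ρ s t : ℝ} (hl : 0 < l) (hL : 0 < L)
    (hQl : ∀ y, l * (y ⬝ᵥ y) ≤ y ⬝ᵥ lyapunovIntegral (companion a b) *ᵥ y)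
    (hQL : ∀ y, y ⬝ᵥ lyapunovIntegral (companion a b) *ᵥ y ≤ L * (y ⬝ᵥ y))
    (hρ : 0 < ρ) (hρe : 16 * L ^ 3 * e ^ 2 ≤ l * ρ ^ 8) (hs : 0 ≤ s) (hst : s ≤ t)
    (hR : ∀ τ ∈ Icc s t, ρ ≤ R τ) :
    t - s ≤ 2 * L * (Real.log (![R s, V s] ⬝ᵥ lyapunovIntegral (companion a b) *ᵥ ![R s, V s]) -
      Real.log (l * ρ ^ 2)) := by
  have hsub : Icc s t ⊆ Ici 0 := fun τ hτ => hs.trans hτ.1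
  have hlow (τ : ℝ) : l * R τ ^ 2 ≤
      ![R τ, V τ] ⬝ᵥ lyapunovIntegral (companion a b) *ᵥ ![R τ, V τ] := by
    refine le_trans (mul_le_mul_of_nonneg_left ?_ hl.le) (hQl _)
    simpa [← sq] using sq_nonneg (V τ)
  have hforce : ∀ τ ∈ Icc s t, 16 * L ^ 3 * (![0, e / R τ ^ 3] ⬝ᵥ ![0, e / R τ ^ 3]) ≤
      ![R τ, V τ] ⬝ᵥ lyapunovIntegral (companion a b) *ᵥ ![R τ, V τ] := by
    intro τ hτ
    refine le_trans ?_ (hlow τ)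
    have hRτ : 0 < R τ := h.pos τ (hsub hτ)
    simp only [vec2_dotProduct, cons_val_zero, cons_val_one, mul_zero, zero_add]
    rw [← sq, div_pow, ← mul_div_assoc, div_le_iff₀ (by positivity)]
    calc 16 * L ^ 3 * e ^ 2 ≤ l * ρ ^ 8 := hρe
      _ ≤ l * R τ ^ 8 := by gcongr; exact hR τ hτ
      _ = l * R τ ^ 2 * (R τ ^ 3) ^ 2 := by ring
  have hdecay := (isExpStable_companion hba ha).dotProduct_lyapunovIntegral_le_exp_mul hL hQL
    hst (fun τ hτ => (h.hasDerivWithinAt_state (hsub hτ)).mono hsub) hforce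
  have hend : l * ρ ^ 2 ≤
      ![R t, V t] ⬝ᵥ lyapunovIntegral (companion a b) *ᵥ ![R t, V t] := by
    refine le_trans ?_ (hlow t)
    gcongr
    exact hR t (right_mem_Icc.2 hst)
  have hlog := Real.log_le_log (by positivity) (hend.trans hdecay)
  have hstart : 0 < ![R s, V s] ⬝ᵥ lyapunovIntegral (companion a b) *ᵥ ![R s, V s] :=
    (mul_pos hl (pow_pos (h.pos s hs) 2)).trans_le (hlow s)
  rw [Real.log_mul (Real.exp_pos _).ne' hstart.ne', Real.log_exp, neg_mul, one_div_mul_eq_div,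
    ← sub_eq_neg_add, le_sub_comm, div_le_iff₀ (by positivity)] at hlog
  linarith

end IsRepelledMotion

end Descent

section FirstHitting

variable {f : ℝ → ℝ} {s t c : ℝ}

theorem exists_isLeast_hitting {T : ℝ} (hf : ContinuousOn f (Ici s)) (hc : c ≤ f s)
    (hT : ∀ t, s ≤ t → (∀ τ ∈ Icc s t, c ≤ f τ) → t ≤ T) :
    ∃ t, IsLeast {τ | s ≤ τ ∧ f τ = c} t ∧ t ≤ T ∧ ∀ τ ∈ Icc s t, c ≤ f τ := by
  have hcross (τ : ℝ) (hsτ : s ≤ τ) (hτ : f τ ≤ c) : ∃ σ ∈ Icc s τ, f σ = c :=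
    intermediate_value_Icc' hsτ (hf.mono Icc_subset_Ici_self) ⟨hτ, hc⟩
  have hne : {τ | s ≤ τ ∧ f τ = c}.Nonempty := by
    by_contra hempty
    have habove (τ : ℝ) (hsτ : s ≤ τ) : c ≤ f τ := by
      by_contra hτ
      obtain ⟨σ, hσ, hfσ⟩ := hcross τ hsτ (not_le.1 hτ).le
      exact hempty ⟨σ, hσ.1, hfσ⟩
    have hle := hT (max s T + 1) (by linarith [le_max_left s T]) fun τ hτ => habove τ hτ.1
    linarith [le_max_right s T]
  have hclosed : IsClosed {τ | s ≤ τ ∧ f τ = c} :=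
    hf.preimage_isClosed_of_isClosed isClosed_Ici isClosed_singleton
  have hleast := hclosed.isLeast_csInf hne ⟨s, fun τ hτ => hτ.1⟩
  have habove : ∀ τ ∈ Icc s (sInf {τ | s ≤ τ ∧ f τ = c}), c ≤ f τ := by
    intro τ hτ
    by_contra hlt
    obtain ⟨σ, hσ, hfσ⟩ := hcross τ hτ.1 (not_le.1 hlt).le
    have hστ : σ = τ := le_antisymm hσ.2 (hτ.2.trans (hleast.2 ⟨hσ.1, hfσ⟩))
    exact hlt (hστ ▸ hfσ.ge)
  exact ⟨_, hleast, hT _ hleast.1.1 habove, habove⟩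

theorem nonpos_of_hasDerivWithinAt_of_forall_le {f' : ℝ} (hst : s < t)
    (hf : HasDerivWithinAt f f' (Icc s t) t) (hmin : ∀ τ ∈ Icc s t, f t ≤ f τ) : f' ≤ 0 := by
  have hcone : s - t ∈ posTangentConeAt (Icc s t) t :=
    sub_mem_posTangentConeAt_of_segment_subset (segment_symm ℝ s t ▸ segment_subset_Icc hst.le)
  have hnonneg := (isMinOn_iff.2 hmin).localize.hasFDerivWithinAt_nonneg hf.hasFDerivWithinAt hcone
  simp only [ContinuousLinearMap.toSpanSingleton_apply, smul_eq_mul] at hnonneg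
  exact nonpos_of_mul_nonneg_right hnonneg (sub_neg.2 hst)

end FirstHitting

section Data

open Real Filter Matrix
open scoped Topology

namespace Data

variable (d : Data) {k ρ : ℝ}

theorem Δ_pos : 0 < d.Δ := sub_pos.2 (one_lt_pow₀ d.one_lt_α two_ne_zero)

theorem sqrt_Δ_pos : 0 < √d.Δ := sqrt_pos.2 d.Δ_pos

theorem ξ₁_add_ξ₂ : d.ξ₁ + d.ξ₂ = -(2 * d.α) := by rw [ξ₁, ξ₂]; ring

theorem ξ₁_sub_ξ₂ : d.ξ₁ - d.ξ₂ = 2 * √d.Δ := by rw [ξ₁, ξ₂]; ring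

theorem ξ₁_mul_ξ₂ : d.ξ₁ * d.ξ₂ = 1 := by
  have hsq : √d.Δ ^ 2 = d.α ^ 2 - 1 := sq_sqrt d.Δ_pos.le
  rw [ξ₁, ξ₂]
  linear_combination -hsq

theorem ξ₂_lt_ξ₁ : d.ξ₂ < d.ξ₁ := by linarith [d.ξ₁_sub_ξ₂, d.sqrt_Δ_pos]

theorem ξ₂_neg : d.ξ₂ < 0 := by linarith [d.ξ₂_lt_ξ₁, d.ξ₁_add_ξ₂, d.one_lt_α]

theorem ξ₁_neg : d.ξ₁ < 0 :=
  neg_of_mul_pos_left (d.ξ₁_mul_ξ₂ ▸ one_pos) d.ξ₂_neg.le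

theorem E_pos : 0 < d.E :=
  div_pos (mul_pos (pow_pos d.dr₀_pos 2) (pow_pos d.ds₀_pos 2)) (mul_pos four_pos d.Δ_pos)

theorem t₀_pos : 0 < d.t₀ := div_pos (neg_pos.2 d.s₀_neg) d.ds₀_pos

theorem η_pos (k : ℝ) : 0 < d.η k := exp_pos _

theorem ε_pos (k : ℝ) : 0 < d.ε k := exp_pos _

theorem ε_lt_one (hk : 0 < k) : d.ε k < 1 :=
  exp_lt_one_iff.2 <| mul_neg_of_neg_of_pos
    (mul_neg_of_neg_of_pos (sub_neg.2 d.ξ₂_lt_ξ₁) d.t₀_pos) (sqrt_pos.2 hk)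

theorem force_nonneg (k : ℝ) : 0 ≤ d.E * (1 - d.ε k) ^ 2 :=
  mul_nonneg d.E_pos.le (sq_nonneg _)

theorem force_le_E (hk : 0 < k) : d.E * (1 - d.ε k) ^ 2 ≤ d.E :=
  mul_le_of_le_one_right d.E_pos.le <|
    pow_le_one₀ (sub_nonneg.2 (d.ε_lt_one hk).le) (sub_le_self 1 (d.ε_pos k).le)

theorem initR_pos (hk : 0 < k) : 0 < d.initR k :=
  div_pos (mul_pos (mul_pos (d.η_pos k) d.dr₀_pos) (sub_pos.2 (d.ε_lt_one hk)))
    (mul_pos two_pos d.sqrt_Δ_pos)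

theorem initV_sub_mul_initR (k : ℝ) :
    d.initV k - d.ξ₁ * d.initR k = d.η k * d.dr₀ * d.ε k := by
  have hΔ := d.sqrt_Δ_pos.ne'
  have hξ₁ := d.ξ₁_neg.ne
  rw [initV, initR]
  field_simp
  linear_combination d.η k * d.dr₀ * d.ε k * d.ξ₁_sub_ξ₂

theorem mul_initR_le_initV (k : ℝ) : d.ξ₁ * d.initR k ≤ d.initV k :=
  sub_nonneg.1 <| d.initV_sub_mul_initR k ▸
    mul_nonneg (mul_nonneg (d.η_pos k).le d.dr₀_pos.le) (d.ε_pos k).le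

theorem force_div_initR_sq (hk : 0 < k) :
    d.E * (1 - d.ε k) ^ 2 / d.initR k ^ 2 = (d.ds₀ / d.η k) ^ 2 := by
  have hε : 1 - d.ε k ≠ 0 := (sub_pos.2 (d.ε_lt_one hk)).ne'
  have hη := (d.η_pos k).ne'
  have hr := d.dr₀_pos.ne'
  have hΔ := d.sqrt_Δ_pos.ne'
  rw [E, ← sq_sqrt d.Δ_pos.le, initR]
  field_simp
  ring

theorem log_one_div_η (k : ℝ) : log (1 / d.η k) = -d.ξ₁ * d.t₀ / 2 * √k := by
  rw [one_div, log_inv, η, log_exp]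
  ring

theorem log_one_div_η_nonneg (k : ℝ) : 0 ≤ log (1 / d.η k) := by
  rw [log_one_div_η]
  have hξ₁ := neg_pos.2 d.ξ₁_neg
  have ht₀ := d.t₀_pos
  positivity

theorem τ₃_nonneg {ζ : ℝ} (hζ : 0 ≤ ζ) (k : ℝ) : 0 ≤ d.τ₃ ζ k :=
  mul_nonneg hζ (d.log_one_div_η_nonneg k)

theorem tendsto_log_one_div_η : Tendsto (fun k => log (1 / d.η k)) atTop atTop := by
  simp only [log_one_div_η]
  exact tendsto_sqrt_atTop.const_mul_atTop
    (half_pos (mul_pos (neg_pos.2 d.ξ₁_neg) d.t₀_pos))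

theorem tendsto_η : Tendsto d.η atTop (𝓝 0) := by
  refine (tendsto_exp_neg_atTop_nhds_zero.comp d.tendsto_log_one_div_η).congr fun k => ?_
  rw [Function.comp_apply, one_div, log_inv, neg_neg, exp_log (d.η_pos k)]

theorem tendsto_ε : Tendsto d.ε atTop (𝓝 0) :=
  tendsto_exp_atBot.comp <| tendsto_sqrt_atTop.const_mul_atTop_of_neg <|
    mul_neg_of_neg_of_pos (sub_neg.2 d.ξ₂_lt_ξ₁) d.t₀_pos

theorem tendsto_initR : Tendsto d.initR atTop (𝓝 0) := by
  have hlim := ((d.tendsto_η.mul_const d.dr₀).mul (d.tendsto_ε.const_sub 1)).div_const (2 * √d.Δ)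
  rw [zero_mul, zero_mul, zero_div] at hlim
  exact hlim

theorem tendsto_initV : Tendsto d.initV atTop (𝓝 0) := by
  have hlim := (((d.tendsto_η.mul_const d.dr₀).mul_const d.ξ₁).mul
    (((d.tendsto_ε.mul_const d.ξ₂).div_const d.ξ₁).const_sub 1)).div_const (2 * √d.Δ)
  rw [zero_mul, zero_mul, zero_mul, zero_div] at hlim
  exact hlim

theorem eventually_F_init_le :
    ∀ᶠ k in atTop, d.F k (d.initR k) (d.initV k) ≤ (d.ds₀ ^ 2 + 1) * (1 / d.η k) ^ 2 := by
  have hlim := (d.tendsto_initR.pow 2).add (d.tendsto_initV.pow 2)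
  rw [zero_pow two_ne_zero, add_zero] at hlim
  filter_upwards [hlim.eventually_le_const one_pos, d.tendsto_η.eventually_le_const one_pos,
    eventually_gt_atTop 0] with k hinit hη hk
  have hη_sq : 1 ≤ (1 / d.η k) ^ 2 := one_le_pow₀ ((one_le_div (d.η_pos k)).2 hη)
  rw [F, d.force_div_initR_sq hk, div_eq_mul_one_div, mul_pow]
  linarith

theorem M_eq_companion : d.M = companion d.ξ₁ d.ξ₂ := by
  rw [M, companion, ξ₁_mul_ξ₂, ξ₁_add_ξ₂, neg_mul]

theorem Q_eq_lyapunovIntegral : d.Q = lyapunovIntegral (companion d.ξ₁ d.ξ₂) := by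
  rw [← M_eq_companion]
  rfl

theorem posDef_Q : d.Q.PosDef :=
  d.Q_eq_lyapunovIntegral ▸ (isExpStable_companion d.ξ₂_lt_ξ₁ d.ξ₁_neg).posDef_lyapunovIntegral

theorem lam₁_pos : 0 < d.lam₁ := sInf_spectrum_pos d.posDef_Q

theorem lam₂_pos : 0 < d.lam₂ := sSup_spectrum_pos d.posDef_Q

theorem quadForm_le (R V : ℝ) : d.quadForm R V ≤ d.lam₂ * (R ^ 2 + V ^ 2) :=
  calc d.quadForm R V ≤ d.lam₂ * (![R, V] ⬝ᵥ ![R, V]) :=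
        le_sSup_spectrum_mul d.posDef_Q.isHermitian ![R, V]
    _ = d.lam₂ * (R ^ 2 + V ^ 2) := by rw [vec2_dotProduct', sq, sq]

theorem quadForm_pos {R : ℝ} (hR : 0 < R) (V : ℝ) : 0 < d.quadForm R V :=
  d.posDef_Q.dotProduct_mulVec_pos fun h₀ => hR.ne' (congrFun h₀ 0)

theorem pos_of_threshold_lt (hρ : d.threshold < ρ) : 0 < ρ :=
  (rpow_pos_of_pos d.E_pos _).trans ((le_max_right _ _).trans_lt hρ)

theorem force_bound_of_threshold_lt (hρ : d.threshold < ρ) :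
    16 * d.lam₂ ^ 3 * d.E ^ 2 ≤ d.lam₁ * ρ ^ 8 := by
  have hE := d.E_pos
  have hlam₁ := d.lam₁_pos
  have hlam₂ := d.lam₂_pos
  set y := 4 * d.E * d.lam₂ ^ (3 / 2 : ℝ) / d.lam₁ ^ (1 / 2 : ℝ) with hy
  have hy₀ : 0 ≤ y := by positivity
  have hyρ : y ^ 2 ≤ ρ ^ 8 :=
    calc y ^ 2 = (y ^ (1 / 4 : ℝ)) ^ 8 := by
          rw [← rpow_natCast (y ^ _), ← rpow_mul hy₀, ← rpow_natCast y]
          norm_num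
      _ ≤ ρ ^ 8 := by gcongr; exact ((le_max_left _ _).trans_lt hρ).le
  have hlam₂_pow : (d.lam₂ ^ (3 / 2 : ℝ)) ^ 2 = d.lam₂ ^ 3 := by
    rw [← rpow_natCast, ← rpow_mul hlam₂.le, ← rpow_natCast]
    norm_num
  rw [hy, ← sqrt_eq_rpow, div_pow, sq_sqrt hlam₁.le, mul_pow, hlam₂_pow,
    div_le_iff₀ hlam₁] at hyρ
  linarith

theorem one_add_ξ₁_mul_pos {ζ : ℝ} (hζ : ζ < 1 / |d.ξ₁|) : 0 < 1 + d.ξ₁ * ζ := by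
  rw [abs_of_neg d.ξ₁_neg, lt_div_iff₀ (neg_pos.2 d.ξ₁_neg)] at hζ
  linarith

/-- The value of `F̄` at `ε = 0`, which bounds `F̄` uniformly in `k`. -/
noncomputable def supFbar (ρ : ℝ) : ℝ := ρ ^ 2 + d.E / ρ ^ 2 + d.ξ₁ ^ 2 * ρ ^ 2

theorem supFbar_pos (hρ : 0 < ρ) : 0 < d.supFbar ρ :=
  add_pos_of_pos_of_nonneg (add_pos (pow_pos hρ 2) (div_pos d.E_pos (pow_pos hρ 2)))
    (mul_nonneg (sq_nonneg _) (sq_nonneg _))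

theorem Fbar_le_supFbar (hk : 0 < k) (ρ : ℝ) : d.Fbar k ρ ≤ d.supFbar ρ := by
  rw [Fbar, supFbar]
  gcongr
  exact d.force_le_E hk

theorem Fbar_pos (hρ : 0 < ρ) (k : ℝ) : 0 < d.Fbar k ρ :=
  add_pos_of_pos_of_nonneg
    (add_pos_of_pos_of_nonneg (pow_pos hρ 2) (div_nonneg (d.force_nonneg k) (sq_nonneg _)))
    (mul_nonneg (sq_nonneg _) (sq_nonneg _))

theorem div_le_sq_of_energy_le {e r v G : ℝ} (he : 0 ≤ e) (hr : r ≠ 0)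
    (hG : r ^ 2 + e / r ^ 2 + v ^ 2 ≤ G) : (e + (e / G) ^ 2) / G ≤ r ^ 2 := by
  -- The crude bound `e / G ≤ r²` drops the term `r⁴` of `e + r⁴ ≤ r² G`; it is fed back there.
  have hr₂ : 0 < r ^ 2 := by positivity
  have hdiv : 0 ≤ e / r ^ 2 := by positivity
  have hG₀ : 0 < G := by linarith [sq_nonneg v]
  have hquad : e + r ^ 2 * r ^ 2 ≤ r ^ 2 * G := by
    have hle : e / r ^ 2 ≤ G - r ^ 2 := by linarith [sq_nonneg v]
    rw [div_le_iff₀ hr₂] at hle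
    linarith
  have hcrude : e / G ≤ r ^ 2 := by
    rw [div_le_iff₀ hG₀]
    linarith [mul_nonneg hr₂.le hr₂.le]
  have hsq : (e / G) ^ 2 ≤ r ^ 2 * r ^ 2 := by
    rw [← sq]
    gcongr
  rw [div_le_iff₀ hG₀]
  linarith

theorem div_Fbar_le_sq_of_F_le (hρ : 0 < ρ) {r v : ℝ} (hr : r ≠ 0)
    (hε : d.ε k ≤ 1 / 2) (hεF : 8 * (d.ε k * d.Fbar k ρ ^ 2) ≤ d.E)
    (hF : d.F k r v ≤ d.Fbar k ρ) : d.E * (1 - d.ε k) / d.Fbar k ρ ≤ r ^ 2 := by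
  have hE := d.E_pos
  have hF₀ := d.Fbar_pos hρ k
  refine le_trans ?_ (div_le_sq_of_energy_le (d.force_nonneg k) hr hF)
  gcongr
  have hcube : (1 / 2) ^ 3 ≤ (1 - d.ε k) ^ 3 := by gcongr; linarith
  have hε_le : d.ε k ≤ d.E * (1 - d.ε k) ^ 3 / d.Fbar k ρ ^ 2 := by
    rw [le_div_iff₀ (by positivity)]
    linarith [mul_le_mul_of_nonneg_left hcube hE.le]
  have hmul := mul_le_mul_of_nonneg_left hε_le
    (mul_nonneg hE.le (sub_nonneg.2 (hε.trans one_half_lt_one.le)))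
  rw [div_pow]
  linarith [show d.E * (1 - d.ε k) * (d.E * (1 - d.ε k) ^ 3 / d.Fbar k ρ ^ 2) =
    (d.E * (1 - d.ε k) ^ 2) ^ 2 / d.Fbar k ρ ^ 2 by ring]

theorem eventually_bounds_of_F_le (hρ : 0 < ρ) :
    ∀ᶠ k in atTop, ∀ r v, 0 < r → d.F k r v ≤ d.Fbar k ρ →
      (√(d.E / (2 * d.supFbar ρ)) ≤ r ∧ r ≤ √(d.supFbar ρ) ∧ |v| ≤ √(d.supFbar ρ)) ∧
      (d.E * (1 - d.ε k) / d.Fbar k ρ ≤ r ^ 2 ∧ r ^ 2 ≤ d.Fbar k ρ ∧ v ^ 2 ≤ d.Fbar k ρ) := by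
  have hE := d.E_pos
  have hlim := (d.tendsto_ε.mul_const (d.supFbar ρ ^ 2)).const_mul 8
  rw [zero_mul, mul_zero] at hlim
  filter_upwards [eventually_gt_atTop 0, d.tendsto_ε.eventually_le_const one_half_pos,
    hlim.eventually_le_const hE] with k hk hε hεB r v hr hF
  have hF₀ := d.Fbar_pos hρ k
  have hFB := d.Fbar_le_supFbar hk ρ
  have hε₀ := d.ε_pos k
  have hεF : 8 * (d.ε k * d.Fbar k ρ ^ 2) ≤ d.E := le_trans (by gcongr) hεB
  have hlower := d.div_Fbar_le_sq_of_F_le hρ hr.ne' hε hεF hF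
  have hdiv : 0 ≤ d.E * (1 - d.ε k) ^ 2 / r ^ 2 := div_nonneg (d.force_nonneg k) (sq_nonneg r)
  have hr_sq : r ^ 2 ≤ d.Fbar k ρ := by
    rw [F] at hF
    linarith [sq_nonneg v]
  have hv_sq : v ^ 2 ≤ d.Fbar k ρ := by
    rw [F] at hF
    linarith [sq_nonneg r]
  refine ⟨⟨sqrt_le_iff.2 ⟨hr.le, le_trans ?_ hlower⟩, le_sqrt_of_sq_le (hr_sq.trans hFB),
    abs_le_sqrt (hv_sq.trans hFB)⟩, hlower, hr_sq, hv_sq⟩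
  rw [← div_div]
  have hhalf : d.E / 2 ≤ d.E * (1 - d.ε k) := by linarith [mul_le_mul_of_nonneg_left hε hE.le]
  exact div_le_div₀ ((half_pos hE).le.trans hhalf) hhalf hF₀ hFB

theorem exists_isScaledMotion (hk : 0 < k) : ∃ R V : ℝ → ℝ, d.IsScaledMotion k R V := by
  obtain ⟨R, V, hR, hV, h⟩ := exists_isRepelledMotion d.ξ₁ (b := d.ξ₂) (d.force_nonneg k)
    (d.initR_pos hk) (d.mul_initR_le_initV k)
  refine ⟨R, V, h.pos, hR, hV, h.deriv_R, fun τ hτ => (h.deriv_V τ hτ).congr_deriv ?_⟩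
  rw [ξ₁_add_ξ₂, ξ₁_mul_ξ₂]
  ring

namespace IsScaledMotion

variable {d} {R V : ℝ → ℝ}

theorem isRepelledMotion (h : d.IsScaledMotion k R V) :
    IsRepelledMotion d.ξ₁ d.ξ₂ (d.E * (1 - d.ε k) ^ 2) R V where
  pos := h.pos
  deriv_R := h.deriv_R
  deriv_V τ hτ := (h.deriv_V τ hτ).congr_deriv (by rw [ξ₁_add_ξ₂, ξ₁_mul_ξ₂]; ring)

theorem mul_initial_le (h : d.IsScaledMotion k R V) : d.ξ₁ * R 0 ≤ V 0 := by
  rw [h.init_R, h.init_V]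
  exact d.mul_initR_le_initV k

theorem antitoneOn_F (h : d.IsScaledMotion k R V) :
    AntitoneOn (fun τ => d.F k (R τ) (V τ)) (Ici 0) := by
  have hanti := h.isRepelledMotion.antitoneOn_energy (by linarith [d.ξ₁_neg, d.ξ₂_neg])
  simp only [ξ₁_mul_ξ₂, one_mul] at hanti
  exact hanti

theorem exp_mul_div_η_le (h : d.IsScaledMotion k R V) (hk : 0 < k) {τ : ℝ} (hτ : 1 ≤ τ) :
    exp (d.ξ₁ * (τ - 1)) * (exp d.ξ₂ * (d.ds₀ / d.η k)) ≤ R τ := by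
  have he := d.force_nonneg k
  have hkick := h.isRepelledMotion.sq_mul_exp_mul_le_sq he
    (by linarith [d.ξ₁_neg, d.ξ₂_neg]) d.ξ₂_lt_ξ₁.le h.mul_initial_le zero_le_one
  have hR₁ : exp d.ξ₂ * (d.ds₀ / d.η k) ≤ R 1 := by
    rw [h.init_R, d.force_div_initR_sq hk, one_pow, one_mul, mul_one] at hkick
    refine (pow_le_pow_iff_left₀ (mul_pos (exp_pos _) (div_pos d.ds₀_pos (d.η_pos k))).le
      (h.pos 1 zero_le_one).le two_ne_zero).1 ?_
    calc (exp d.ξ₂ * (d.ds₀ / d.η k)) ^ 2 = exp (2 * d.ξ₂) * (d.ds₀ / d.η k) ^ 2 := by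
          rw [mul_pow, ← exp_nat_mul, Nat.cast_two]
      _ ≤ exp (2 * d.ξ₂) * ((V 0 - d.ξ₁ * d.initR k) ^ 2 + (d.ds₀ / d.η k) ^ 2) := by
          gcongr
          exact le_add_of_nonneg_left (sq_nonneg _)
      _ ≤ R 1 ^ 2 := hkick
  exact (mul_le_mul_of_nonneg_left hR₁ (exp_pos _).le).trans
    (h.isRepelledMotion.exp_mul_le he h.mul_initial_le zero_le_one hτ)

theorem exists_isLeast_hitting (h : d.IsScaledMotion k R V) (hk : 0 < k) (hρ : d.threshold < ρ)
    {s : ℝ} (hs : 0 ≤ s) (hRs : ρ < R s) :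
    ∃ t, IsLeast {τ | s ≤ τ ∧ R τ = ρ} t ∧
      t ≤ s + 2 * d.lam₂ * (log (d.quadForm (R s) (V s)) - log (d.lam₁ * ρ ^ 2)) ∧
      V t ≤ 0 := by
  have hρ₀ := d.pos_of_threshold_lt hρ
  have hE := d.force_le_E hk
  have he := d.force_nonneg k
  have hlam₂ := d.lam₂_pos
  have hforce : 16 * d.lam₂ ^ 3 * (d.E * (1 - d.ε k) ^ 2) ^ 2 ≤ d.lam₁ * ρ ^ 8 :=
    le_trans (by gcongr) (d.force_bound_of_threshold_lt hρ)
  have hQ := d.posDef_Q.isHermitian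
  have hlower (y : Fin 2 → ℝ) : d.lam₁ * (y ⬝ᵥ y) ≤ y ⬝ᵥ d.Q *ᵥ y := sInf_spectrum_mul_le hQ y
  have hupper (y : Fin 2 → ℝ) : y ⬝ᵥ d.Q *ᵥ y ≤ d.lam₂ * (y ⬝ᵥ y) := le_sSup_spectrum_mul hQ y
  have hdescent (t : ℝ) (hst : s ≤ t) (hR : ∀ τ ∈ Icc s t, ρ ≤ R τ) :
      t ≤ s + 2 * d.lam₂ * (log (d.quadForm (R s) (V s)) - log (d.lam₁ * ρ ^ 2)) := by
    rw [Q_eq_lyapunovIntegral] at hlower hupper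
    rw [quadForm, Q_eq_lyapunovIntegral]
    exact sub_le_iff_le_add'.1 <| h.isRepelledMotion.sub_le_log_sub_log d.ξ₂_lt_ξ₁ d.ξ₁_neg
      d.lam₁_pos hlam₂ hlower hupper hρ₀ hforce hs hst hR
  have hcont : ContinuousOn R (Ici s) :=
    fun t ht => (h.deriv_R t (hs.trans ht)).continuousWithinAt.mono (Ici_subset_Ici.2 hs)
  obtain ⟨t, hleast, ht, habove⟩ := CornerPenalty.exists_isLeast_hitting hcont hRs.le hdescent
  have hst : s < t := hleast.1.1.lt_of_ne fun hst => hRs.ne' (hst ▸ hleast.1.2)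
  refine ⟨t, hleast, ht, nonpos_of_hasDerivWithinAt_of_forall_le hst
    ((h.deriv_R t (hs.trans hst.le)).mono fun τ hτ => hs.trans hτ.1) ?_⟩
  rwa [hleast.1.2]

theorem mul_le_velocity (h : d.IsScaledMotion k R V) {τ : ℝ} (hτ : 0 ≤ τ) : d.ξ₁ * R τ ≤ V τ :=
  h.isRepelledMotion.mul_le_velocity (d.force_nonneg k) h.mul_initial_le hτ

theorem F_le_Fbar (h : d.IsScaledMotion k R V) {τ : ℝ} (hτ : 0 ≤ τ) (hV : V τ ≤ 0) :
    d.F k (R τ) (V τ) ≤ d.Fbar k (R τ) := by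
  have hsq : V τ ^ 2 ≤ (d.ξ₁ * R τ) ^ 2 :=
    sq_le_sq.2 (abs_le_abs_of_nonpos hV (h.mul_le_velocity hτ))
  rw [F, Fbar, ← mul_pow]
  gcongr

theorem quadForm_le_F_init (h : d.IsScaledMotion k R V) {τ : ℝ} (hτ : 0 ≤ τ) :
    d.quadForm (R τ) (V τ) ≤ d.lam₂ * d.F k (d.initR k) (d.initV k) := by
  have hanti : d.F k (R τ) (V τ) ≤ d.F k (d.initR k) (d.initV k) := by
    rw [← h.init_R, ← h.init_V]
    exact h.antitoneOn_F self_mem_Ici hτ hτ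
  have hdiv : 0 ≤ d.E * (1 - d.ε k) ^ 2 / R τ ^ 2 :=
    div_nonneg (d.force_nonneg k) (sq_nonneg _)
  refine (d.quadForm_le _ _).trans (mul_le_mul_of_nonneg_left ?_ d.lam₂_pos.le)
  rw [F] at hanti
  linarith

end IsScaledMotion

theorem eventually_lt_R_τ₃ {ζ : ℝ} (hζ : 0 < ζ) (hζξ : ζ < 1 / |d.ξ₁|) (ρ : ℝ) :
    ∀ᶠ k in atTop, ∀ R V, d.IsScaledMotion k R V → ρ < R (d.τ₃ ζ k) := by
  have hgrowth : Tendsto (fun k => exp (d.ξ₂ - d.ξ₁) * d.ds₀ *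
      exp ((1 + d.ξ₁ * ζ) * log (1 / d.η k))) atTop atTop :=
    (tendsto_exp_atTop.comp (d.tendsto_log_one_div_η.const_mul_atTop
      (d.one_add_ξ₁_mul_pos hζξ))).const_mul_atTop (mul_pos (exp_pos _) d.ds₀_pos)
  filter_upwards [eventually_gt_atTop 0, hgrowth.eventually_gt_atTop ρ,
    (d.tendsto_log_one_div_η.const_mul_atTop hζ).eventually_ge_atTop 1] with k hk hρ hτ₃ R V h
  refine hρ.trans_le (le_of_eq_of_le ?_ (h.exp_mul_div_η_le hk hτ₃))
  have hη : d.ds₀ / d.η k = d.ds₀ * exp (log (1 / d.η k)) := by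
    rw [exp_log (one_div_pos.2 (d.η_pos k)), div_eq_mul_one_div]
  rw [hη, τ₃, show d.ξ₁ * (ζ * log (1 / d.η k) - 1) =
    d.ξ₁ * ζ * log (1 / d.η k) - d.ξ₁ by ring, add_mul, one_mul, exp_add, exp_sub, exp_sub]
  ring

theorem eventually_log_quadForm_sub_log_le (ρ : ℝ) :
    ∀ᶠ k in atTop, ∀ R V, d.IsScaledMotion k R V → ∀ τ, 0 ≤ τ →
      log (d.quadForm (R τ) (V τ)) - log (d.lam₁ * ρ ^ 2) ≤ 3 * log (1 / d.η k) := by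
  filter_upwards [d.eventually_F_init_le, d.tendsto_log_one_div_η.eventually_ge_atTop
    (log (d.lam₂ * (d.ds₀ ^ 2 + 1)) - log (d.lam₁ * ρ ^ 2))] with k hF hlog R V h τ hτ
  have hlam₂ := d.lam₂_pos
  have hη : 0 < 1 / d.η k := one_div_pos.2 (d.η_pos k)
  have hle : d.quadForm (R τ) (V τ) ≤ d.lam₂ * (d.ds₀ ^ 2 + 1) * (1 / d.η k) ^ 2 := by
    rw [mul_assoc]
    exact (h.quadForm_le_F_init hτ).trans (mul_le_mul_of_nonneg_left hF hlam₂.le)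
  have hlog_le := log_le_log (d.quadForm_pos (h.pos τ hτ) _) hle
  rw [log_mul (by positivity) (by positivity), log_pow, Nat.cast_two] at hlog_le
  linarith

end Data

end Data

end CornerPenalty

theorem mainTheorem8 (d : CornerPenalty.Data) (Rbar : ℝ) (hRbar : d.threshold < Rbar) :
    ∃ Rm RM VM : ℝ, 0 < Rm ∧ 0 < RM ∧ 0 < VM ∧
      ∀ ζ : ℝ, 0 < ζ → ζ < 1 / |d.ξ₁| →
        ∃ C k₀ : ℝ, 0 < C ∧ 0 < k₀ ∧ ∀ k : ℝ, k₀ ≤ k →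
          (∃ R V : ℝ → ℝ, d.IsScaledMotion k R V) ∧
          ∀ R V : ℝ → ℝ, d.IsScaledMotion k R V →
            ∃ τ₄ : ℝ,
              IsLeast {τ : ℝ | d.τ₃ ζ k ≤ τ ∧ R τ = Rbar} τ₄ ∧
              τ₄ ≤ d.τ₃ ζ k + 2 * d.lam₂ *
                (Real.log (d.quadForm (R (d.τ₃ ζ k)) (V (d.τ₃ ζ k)))
                  - Real.log (d.lam₁ * Rbar ^ 2)) ∧
              τ₄ ≤ d.τ₃ ζ k + C * Real.log (1 / d.η k) ∧
              d.ξ₁ * Rbar ≤ V τ₄ ∧ V τ₄ ≤ 0 ∧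
              d.F k (R τ₄) (V τ₄) ≤ d.Fbar k Rbar ∧
              ∀ τ : ℝ, τ₄ ≤ τ →
                (Rm ≤ R τ ∧ R τ ≤ RM ∧ |V τ| ≤ VM) ∧
                (d.E * (1 - d.ε k) / d.Fbar k Rbar ≤ R τ ^ 2 ∧
                  R τ ^ 2 ≤ d.Fbar k Rbar ∧ V τ ^ 2 ≤ d.Fbar k Rbar) := by
  have hR₀ := d.pos_of_threshold_lt hRbar
  have hB := d.supFbar_pos hR₀
  have hlam₂ := d.lam₂_pos
  refine ⟨√(d.E / (2 * d.supFbar Rbar)), √(d.supFbar Rbar), √(d.supFbar Rbar),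
    Real.sqrt_pos.2 (div_pos d.E_pos (mul_pos two_pos hB)), Real.sqrt_pos.2 hB,
    Real.sqrt_pos.2 hB, fun ζ hζ hζξ => ?_⟩
  obtain ⟨k₁, hk₁⟩ := Filter.eventually_atTop.1 <| (d.eventually_lt_R_τ₃ hζ hζξ Rbar).and <|
    (d.eventually_log_quadForm_sub_log_le Rbar).and (d.eventually_bounds_of_F_le hR₀)
  refine ⟨6 * d.lam₂, max k₁ 1, by positivity, by positivity, fun k hk => ?_⟩
  have hk₀ : 0 < k := one_pos.trans_le ((le_max_right _ _).trans hk)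
  obtain ⟨hgrowth, hlog, hbounds⟩ := hk₁ k ((le_max_left _ _).trans hk)
  refine ⟨d.exists_isScaledMotion hk₀, fun R V h => ?_⟩
  have hτ₃ := d.τ₃_nonneg hζ.le k
  obtain ⟨τ₄, hleast, hτ₄_le, hV⟩ := h.exists_isLeast_hitting hk₀ hRbar hτ₃ (hgrowth R V h)
  have hτ₄ := hτ₃.trans hleast.1.1
  have hRτ₄ : R τ₄ = Rbar := hleast.1.2
  have hF : d.F k (R τ₄) (V τ₄) ≤ d.Fbar k Rbar := (h.F_le_Fbar hτ₄ hV).trans_eq (by rw [hRτ₄])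
  refine ⟨τ₄, hleast, hτ₄_le, ?_, hRτ₄ ▸ h.mul_le_velocity hτ₄, hV, hF, fun τ hτ => ?_⟩
  · linarith [mul_le_mul_of_nonneg_left (hlog R V h _ hτ₃) (mul_pos two_pos hlam₂).le]
  · exact hbounds _ _ (h.pos τ (hτ₄.trans hτ)) ((h.antitoneOn_F hτ₄ (hτ₄.trans hτ) hτ).trans hF)
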